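/- All graphs are finite, simple and labeled; a graph of order $n$ is a graph on a fixed vertex set of $n$ elements, and its size is its number of edges. The graph of order $0$ is bipartite, has $0$ connected components and is not connected. Put $$\mathcal B(x,y)=\frac12\log\Bigl(1+\sum_{n\ge 1,\,k\ge 0}\Bigl(\sum_{i=0}^n\binom ni\binom{i(n-i)}k\Bigr)\frac{x^ny^k}{n!}\Bigr)\in\mathbb Q[[x,y]],$$ with $\log$ the formal logarithm. Let $a_{n,k}$ denote the coefficient of $x^ny^k$ in $\mathcal B$, and let $$\tilde{\mathcal B}=\sum_{n\ge 1,\,k\ge 0}a_{n,k}\,x^ny^kz_n\in\mathbb Q[z_1,z_2,\dots][[x,y]].$$ For $\omega=(\omega_1,\omega_2,\dots)\in\mathbb Q^\infty$ let $\tau_\omega:\mathbb Q[z_1,z_2,\dots]\to\overline{\mathbb Q(z)}$ be the ring homomorphism with $\prod_i z_i^{\alpha_i}\mapsto z^{\sum_i\omega_i\alpha_i}$ (for a fixed compatible choice of rational powers of $z$ with $z^1=z$), extended coefficientwise to power series in $x,y$. Then: (1) For all $n,k\ge 0$, $a_{n,k}=\bar b_{n,k}/n!$, where $\bar b_{n,k}$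 is the number of connected bipartite graphs of order $n$ and size $k$. (2) For $\omega=(1,1,1,\dots)$ there is an expansion $$\tau_\omega(\exp\tilde{\mathcal B})=\sum_{n,k,\nu\ge 0}b_{n,k,\nu}\,\frac1{n!}\,x^ny^kz^\nu$$ with $b_{n,k,\nu}\in\mathbb Q$ and, for each $n,k$, only finitely many $b_{n,k,\nu}$ nonzero; and in any such expansion $b_{n,k,\nu}$ is the number of bipartite graphs of order $n$ and size $k$ with exactly $\nu$ connected components. -/

import Mathlib

namespace BipartiteEnum

noncomputable section

/-! ### Counting labeled graphs

Labeled graphs of order `n` are the simple graphs on `Fin n`; the size is the number of edges. -/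

/-- The number of connected bipartite labeled graphs of order `n` and size `k`. -/
def connectedBipartiteCount (n k : ℕ) : ℕ :=
  Nat.card {G : SimpleGraph (Fin n) // G.IsBipartite ∧ G.Connected ∧ G.edgeSet.ncard = k}

/-- The number of bipartite labeled graphs of order `n` and size `k` with `ν` connected
components. -/
def bipartiteCount (n k ν : ℕ) : ℕ :=
  Nat.card {G : SimpleGraph (Fin n) //
    G.IsBipartite ∧ G.edgeSet.ncard = k ∧ Nat.card G.ConnectedComponent = ν}

/-! ### Formal power series in two variables -/

/-- Formal power series in `x` and `y` over `R`, written as `R⟦y⟧⟦x⟧`. -/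
abbrev Series (R : Type) [CommRing R] : Type := PowerSeries (PowerSeries R)

/-- The series `∑ a n k * x ^ n * y ^ k`. -/
def series {R : Type} [CommRing R] (a : ℕ → ℕ → R) : Series R :=
  PowerSeries.mk fun n => PowerSeries.mk fun k => a n k

/-- The coefficient of `x ^ n * y ^ k`. -/
def coeffXY {R : Type} [CommRing R] (n k : ℕ) (f : Series R) : R :=
  PowerSeries.coeff k (PowerSeries.coeff n f)

/-- The formal exponential `∑ f ^ m / m!` of a series `f` without terms of degree `0` in `x`. -/
def expSeries {R : Type} [CommRing R] [Algebra ℚ R] (f : Series R) : Series R :=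
  (PowerSeries.exp (PowerSeries R)).subst f

/-- The generating function of bi-colored graphs:
`1 + ∑_{n ≥ 1, k ≥ 0} (∑_i C(n,i) C(i(n-i),k)) x ^ n y ^ k / n!`. -/
def bicolored : Series ℚ :=
  1 + series fun n k =>
    if n = 0 then 0
    else (∑ i ∈ Finset.range (n + 1), ((n.choose i * (i * (n - i)).choose k : ℕ) : ℚ)) /
      (n.factorial : ℚ)

/-- `B = (1/2) log (bicolored)`. -/
def B : Series ℚ := (1 / 2 : ℚ) • PowerSeries.logOf bicolored

/-! ### The auxiliary variables `z₁, z₂, …` and the homomorphism `τ_ω` -/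

/-- For `f = ∑ a n k x ^ n y ^ k`, the series `∑_{n ≥ 1} a n k x ^ n y ^ k z_n`, with coefficients
in `ℚ[z₁, z₂, …]`. -/
def tilde (f : Series ℚ) : Series (MvPolynomial ℕ+ ℚ) :=
  series fun n k =>
    if h : 0 < n then MvPolynomial.C (coeffXY n k f) * MvPolynomial.X ⟨n, h⟩ else 0

/-- The algebraic closure of `ℚ(z)`. -/
abbrev ZField : Type := AlgebraicClosure (RatFunc ℚ)

/-- The variable `z`. -/
def z : ZField := algebraMap (RatFunc ℚ) ZField RatFunc.X

theorem z_ne_zero : z ≠ 0 := by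
  unfold z
  rw [Ne, map_eq_zero_iff _ (algebraMap (RatFunc ℚ) ZField).injective]
  exact RatFunc.X_ne_zero

/-- There is a compatible system of rational powers of `z`. -/
theorem exists_zPow : ∃ p : Multiplicative ℚ →* ZField, p (Multiplicative.ofAdd 1) = z := by
  have hsurj : ∀ {n : ℕ}, n ≠ 0 → Function.Surjective fun a : Additive ZFieldˣ => n • a := by
    intro n hn a
    obtain ⟨w, hw⟩ := IsAlgClosed.exists_pow_nat_eq ((a.toMul : ZFieldˣ) : ZField)
      (Nat.pos_of_ne_zero hn)
    have hw0 : w ≠ 0 := by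
      rintro rfl
      rw [zero_pow hn] at hw
      exact (a.toMul : ZFieldˣ).ne_zero hw.symm
    refine ⟨Additive.ofMul (Units.mk0 w hw0), ?_⟩
    apply Additive.toMul.injective
    ext
    simpa using hw
  let : DivisibleBy (Additive ZFieldˣ) ℕ := divisibleByOfSMulRightSurj _ _ hsurj
  let : DivisibleBy (Additive ZFieldˣ) ℤ := AddGroup.divisibleByIntOfDivisibleByNat _
  obtain ⟨h, hh⟩ := (Module.Baer.of_divisible (Additive ZFieldˣ)).extension_property_addMonoidHom
    (Int.castAddHom ℚ) Int.cast_injective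
    (zmultiplesHom (Additive ZFieldˣ) (Additive.ofMul (Units.mk0 z z_ne_zero)))
  refine ⟨(Units.coeHom ZField).comp (AddMonoidHom.toMultiplicativeLeft h), ?_⟩
  have h1 : h 1 = Additive.ofMul (Units.mk0 z z_ne_zero) := by
    have := DFunLike.congr_fun hh 1
    simpa using this
  simp [h1]

/-- A fixed compatible system of rational powers `q ↦ z ^ q`, with `z ^ 1 = z`. -/
def zPow : Multiplicative ℚ →* ZField := Classical.choose exists_zPow

theorem zPow_one : zPow (Multiplicative.ofAdd 1) = z := Classical.choose_spec exists_zPow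

/-- The ring homomorphism `τ_ω` from `ℚ[z₁, z₂, …]` to the algebraic closure of `ℚ(z)` with
`z_i ↦ z ^ ω_i`, hence `∏ z_i ^ α_i ↦ z ^ (∑ ω_i α_i)`. -/
def tau (ω : ℕ+ → ℚ) : MvPolynomial ℕ+ ℚ →+* ZField :=
  (MvPolynomial.aeval fun i => zPow (Multiplicative.ofAdd (ω i)) :
    MvPolynomial ℕ+ ℚ →ₐ[ℚ] ZField).toRingHom

/-- The extension of `τ_ω` to power series in `x` and `y`, coefficient by coefficient. -/
def tauSeries (ω : ℕ+ → ℚ) : Series (MvPolynomial ℕ+ ℚ) →+* Series ZField :=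
  PowerSeries.map (PowerSeries.map (tau ω))

/-- `F = ∑ b n k ν * x ^ n * y ^ k * z ^ ν / n!`, where for each `n, k` only finitely many `ν`
occur. -/
def HasExpansion (F : Series ZField) (b : ℕ → ℕ → ℕ →₀ ℚ) : Prop :=
  F = series fun n k =>
    (b n k).sum fun ν c => algebraMap ℚ ZField (c / (n.factorial : ℚ)) * z ^ ν

end

end BipartiteEnum

namespace BipartiteEnum

noncomputable section

open scoped Classical
open Finset SimpleGraph

/-! Give a bipartite graph the weight `y ^ size * t ^ components`. Let `F_t` be the resulting
exponential generating function (`bipSeries`) and `C` the one for connected bipartite graphs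
(`connSeries`). Two countings carry the proof.

Splitting off the component of a fixed vertex (`bipSum_fin_succ`) gives `F_t' = (t C)' F_t` with
`F_t(0) = 1` (`derivative_bipSeries`), the equation that characterizes `exp (t C)`.

A bipartite graph has `2 ^ components` two-colorings, so double counting pairs (graph, coloring)
identifies `F_2` with `bicolored` (`bipSeries_two`).

At `t = 2`, logarithmic differentiation yields `log bicolored = 2 C`, hence `B = C`, which is (1).
At `t = z`, the image of `exp (tilde B)` under `tau` solves the same equation as `F_z`, so they
agree. The coefficients of `F_z` are polynomials in `z` that record component counts, and
transcendence of `z` over `ℚ` makes the expansion unique, which is (2). -/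

/-! ### Connected components of disjoint sums -/

/-- The connected components of a disjoint sum. -/
def sumComponentsEquiv {V W : Type*} (G : SimpleGraph V) (H : SimpleGraph W) :
    (G ⊕g H).ConnectedComponent ≃ G.ConnectedComponent ⊕ H.ConnectedComponent where
  toFun := ConnectedComponent.lift
    (Sum.map G.connectedComponentMk H.connectedComponentMk) fun v w p _ => by
      induction p with
      | nil => rfl
      | @cons u v w h p ih =>
        refine Eq.trans ?_ (ih ((Walk.cons_isPath_iff h p).1 (by assumption)).1)
        rcases u with u | u <;> rcases v with v | v
        · simpa using Adj.reachable (by simpa using h)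
        · simp at h
        · simp at h
        · simpa using Adj.reachable (by simpa using h)
  invFun := Sum.elim (ConnectedComponent.map Embedding.sumInl.toHom)
    (ConnectedComponent.map Embedding.sumInr.toHom)
  left_inv c := by
    induction c using ConnectedComponent.ind with
    | h v => rcases v with v | v <;> rfl
  right_inv c := by
    rcases c with c | c <;> induction c using ConnectedComponent.ind <;> rfl

theorem reachable_sum_inl {V W : Type*} {G : SimpleGraph V} {H : SimpleGraph W} {u v : V} :
    (G ⊕g H).Reachable (.inl u) (.inl v) ↔ G.Reachable u v := by
  rw [← ConnectedComponent.eq, ← (sumComponentsEquiv G H).injective.eq_iff,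
    ← ConnectedComponent.eq]
  exact Sum.inl_injective.eq_iff

/-! ### Weighted sums over graphs -/

section WeightedSums

variable {R : Type*} [CommRing R]

/-- The weight `y ^ size * z ^ components` of a bipartite graph. -/
def bipWeight {V : Type*} (y z : R) (G : SimpleGraph V) : R :=
  if G.IsBipartite then y ^ G.edgeSet.ncard * z ^ Nat.card G.ConnectedComponent else 0

/-- The weight `y ^ size` of a connected bipartite graph. -/
def connWeight {V : Type*} (y : R) (G : SimpleGraph V) : R :=
  if G.IsBipartite ∧ G.Connected then y ^ G.edgeSet.ncard else 0

/-- The weighted number of bipartite graphs on `V`. -/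
def bipSum (V : Type*) [Fintype V] (y z : R) : R := ∑ G : SimpleGraph V, bipWeight y z G

/-- The weighted number of connected bipartite graphs on `V`. -/
def connSum (V : Type*) [Fintype V] (y : R) : R := ∑ G : SimpleGraph V, connWeight y G

theorem ncard_edgeSet_eq_of_iso {V W : Type*} {G : SimpleGraph V} {H : SimpleGraph W}
    (e : G ≃g H) : G.edgeSet.ncard = H.edgeSet.ncard :=
  Nat.card_congr e.mapEdgeSet

theorem isBipartite_iff_of_iso {V W : Type*} {G : SimpleGraph V} {H : SimpleGraph W}
    (e : G ≃g H) : G.IsBipartite ↔ H.IsBipartite :=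
  ⟨fun h => h.of_hom e.symm.toHom, fun h => h.of_hom e.toHom⟩

theorem bipWeight_eq_of_iso {V W : Type*} {G : SimpleGraph V} {H : SimpleGraph W}
    (e : G ≃g H) (y z : R) : bipWeight y z G = bipWeight y z H := by
  simp only [bipWeight, isBipartite_iff_of_iso e, ncard_edgeSet_eq_of_iso e,
    Nat.card_congr e.connectedComponentEquiv]

theorem connWeight_eq_of_iso {V W : Type*} {G : SimpleGraph V} {H : SimpleGraph W}
    (e : G ≃g H) (y : R) : connWeight y G = connWeight y H := by
  simp only [connWeight, isBipartite_iff_of_iso e, ncard_edgeSet_eq_of_iso e, e.connected_iff]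

/-- A graph is isomorphic to its transport along a bijection of the vertices. -/
def isoSimpleGraph {V W : Type*} (e : V ≃ W) (G : SimpleGraph V) : G ≃g e.simpleGraph G where
  toEquiv := e
  map_rel_iff' := by simp [Equiv.simpleGraph]

theorem bipSum_congr {V W : Type*} [Fintype V] [Fintype W] (e : V ≃ W) (y z : R) :
    bipSum V y z = bipSum W y z :=
  Fintype.sum_equiv e.simpleGraph _ _ fun G => bipWeight_eq_of_iso (isoSimpleGraph e G) y z

theorem connSum_congr {V W : Type*} [Fintype V] [Fintype W] (e : V ≃ W) (y : R) :
    connSum V y = connSum W y :=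
  Fintype.sum_equiv e.simpleGraph _ _ fun G => connWeight_eq_of_iso (isoSimpleGraph e G) y

theorem bipWeight_sum {V W : Type*} [Finite V] [Finite W] (G : SimpleGraph V) (H : SimpleGraph W)
    (y z : R) : bipWeight y z (G ⊕g H) = bipWeight y z G * bipWeight y z H := by
  have he : (G ⊕g H).edgeSet.ncard = G.edgeSet.ncard + H.edgeSet.ncard :=
    (Nat.card_congr edgeSetSumEquiv).trans Nat.card_sum
  have hc : Nat.card (G ⊕g H).ConnectedComponent =
      Nat.card G.ConnectedComponent + Nat.card H.ConnectedComponent :=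
    (Nat.card_congr (sumComponentsEquiv G H)).trans Nat.card_sum
  have hb : (G ⊕g H).IsBipartite ↔ G.IsBipartite ∧ H.IsBipartite := colorable_sum
  simp only [bipWeight, he, hc, hb, ite_and]
  split_ifs <;> ring

theorem bipWeight_of_connected {V : Type*} {G : SimpleGraph V} (hG : G.Connected) (y z : R) :
    bipWeight y z G = z * connWeight y G := by
  have : Nat.card G.ConnectedComponent = 1 := by
    rw [Nat.card_eq_one_iff_unique]
    exact ⟨hG.preconnected.subsingleton_connectedComponent, ⟨G.connectedComponentMk hG.nonempty.some⟩⟩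
  simp only [bipWeight, connWeight, hG, this, and_true]
  split_ifs <;> ring

/-! ### Splitting off the component of a vertex -/

/-- `V` as the disjoint union of the complement of `B` and of `B`. -/
def splitEquiv {V : Type*} (B : Finset V) : {x // x ∉ B} ⊕ {x // x ∈ B} ≃ V :=
  (Equiv.sumComm _ _).trans (Equiv.sumCompl (· ∈ B))

/-- The vertices outside of the component of `r`. -/
def outside {V : Type*} [Fintype V] (r : V) (G : SimpleGraph V) : Finset V :=
  univ.filter fun v => ¬ G.Reachable r v

/-- Connectedness of `G` puts the whole left summand in the component of `r`, and no edge leads from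
there to the right summand. -/
theorem outside_splitEquiv {V : Type*} [Fintype V] {r : V} {B : Finset V} (hr : r ∉ B)
    {G : SimpleGraph {x // x ∉ B}} (hG : G.Connected) (H : SimpleGraph {x // x ∈ B}) :
    outside r ((splitEquiv B).simpleGraph (G ⊕g H)) = B := by
  ext v
  have key : ∀ w : {x // x ∉ B} ⊕ {x // x ∈ B},
      ((splitEquiv B).simpleGraph (G ⊕g H)).Reachable r (splitEquiv B w) ↔
        (G ⊕g H).Reachable (.inl ⟨r, hr⟩) w := fun w =>
    Iso.reachable_iff (φ := isoSimpleGraph (splitEquiv B) (G ⊕g H)) (u := .inl ⟨r, hr⟩) (v := w)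
  simp only [outside, mem_filter, mem_univ, true_and]
  by_cases hv : v ∈ B
  · have := (key (.inr ⟨v, hv⟩)).not.2 (not_reachable_sum_inl_inr _ _)
    exact iff_of_true this hv
  · have := (key (.inl ⟨v, hv⟩)).2 (reachable_sum_inl.2 (hG.preconnected _ _))
    exact iff_of_false (not_not.2 this) hv

theorem connected_induce_of_outside_eq {V : Type*} [Fintype V] {r : V} {B : Finset V}
    {G : SimpleGraph V} (h : outside r G = B) :
    (G.comap (Subtype.val : {x // x ∉ B} → V)).Connected := by
  have hB : {x | x ∉ B} = (G.connectedComponentMk r).supp := by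
    ext v
    simp [← h, outside, reachable_comm]
  have := (G.connectedComponentMk r).connected_toSimpleGraph
  unfold ConnectedComponent.toSimpleGraph at this
  have h2 : (G.induce {x | x ∉ B}).Connected := by
    rw [hB]; exact this
  exact h2

theorem mul_connSum {V : Type*} [Fintype V] (y z : R) :
    z * connSum V y = ∑ G : SimpleGraph V with G.Connected, bipWeight y z G := by
  rw [connSum, mul_sum, sum_filter]
  refine sum_congr rfl fun G _ => ?_
  split_ifs with h
  · exact (bipWeight_of_connected h y z).symm
  · simp [connWeight, h]

/-- No edge leaves the component of `r`, so such a graph is freely assembled from a connected graph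
off `B` and an arbitrary graph on `B`; weights multiply over disjoint sums. -/
theorem sum_outside_eq {V : Type*} [Fintype V] {r : V} {B : Finset V} (hr : r ∉ B) (y z : R) :
    ∑ G : SimpleGraph V with outside r G = B, bipWeight y z G =
      z * connSum {x // x ∉ B} y * bipSum {x // x ∈ B} y z := by
  rw [mul_connSum, bipSum, sum_mul_sum, ← sum_product']
  symm
  refine sum_bij' (fun p _ => (splitEquiv B).simpleGraph (p.1 ⊕g p.2))
    (fun G _ => (G.comap Subtype.val, G.comap Subtype.val)) ?_ ?_ ?_ ?_ ?_
  · rintro ⟨G, H⟩ h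
    simp only [mem_product, mem_filter, mem_univ, true_and, and_true] at h ⊢
    exact outside_splitEquiv hr h H
  · intro G h
    simp only [mem_product, mem_filter, mem_univ, true_and, and_true] at h ⊢
    exact connected_induce_of_outside_eq h
  · rintro ⟨G, H⟩ h
    refine Prod.ext ?_ ?_
    · ext u v
      simp [Equiv.simpleGraph, splitEquiv, u.2, v.2]
    · ext u v
      simp [Equiv.simpleGraph, splitEquiv, u.2, v.2]
  · intro G h
    simp only [mem_filter, mem_univ, true_and] at h
    have hB : ∀ v, v ∈ B ↔ ¬ G.Reachable r v := fun v => by simp [← h, outside]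
    ext u v
    have huv : G.Adj u v → (u ∈ B ↔ v ∈ B) := fun a => by
      rw [hB, hB]
      exact not_congr ⟨fun h => h.trans a.reachable, fun h => h.trans a.reachable.symm⟩
    -- By `huv` no edge crosses between `B` and its complement, so the two restrictions lose
    -- nothing.
    by_cases hu : u ∈ B <;> by_cases hv : v ∈ B <;>
      simp [Equiv.simpleGraph, splitEquiv, hu, hv] <;> simpa [hu, hv] using huv
  · rintro ⟨G, H⟩ h
    rw [← bipWeight_eq_of_iso (isoSimpleGraph (splitEquiv B) (G ⊕g H)), bipWeight_sum]

theorem bipSum_eq_sum_powerset {V : Type*} [Fintype V] (r : V) (y z : R) :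
    bipSum V y z = ∑ B ∈ ((univ : Finset V).erase r).powerset,
      z * connSum {x // x ∉ B} y * bipSum {x // x ∈ B} y z := by
  rw [bipSum, ← sum_fiberwise_of_maps_to (g := outside r)
    (t := ((univ : Finset V).erase r).powerset)]
  · refine sum_congr rfl fun B hB => ?_
    exact sum_outside_eq (fun h => by simpa using mem_powerset.1 hB h) y z
  · intro G _
    rw [mem_powerset]
    intro v hv
    simp only [outside, mem_filter, mem_univ, true_and] at hv
    simp only [mem_erase, mem_univ, and_true]
    rintro rfl
    exact hv (Reachable.refl _)

/-- The split-off component is that of vertex `0`; the `j` vertices outside it come from the other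
`n`, whence `n.choose j`. -/
theorem bipSum_fin_succ (n : ℕ) (y z : R) :
    bipSum (Fin (n + 1)) y z =
      ∑ j ∈ range (n + 1), n.choose j •
        (z * connSum (Fin (n + 1 - j)) y * bipSum (Fin j) y z) := by
  have h2 := sum_powerset_apply_card
    (fun j => z * connSum (Fin (n + 1 - j)) y * bipSum (Fin j) y z)
    (x := (univ : Finset (Fin (n + 1))).erase 0)
  rw [show ((univ : Finset (Fin (n + 1))).erase 0).card = n by simp] at h2
  rw [← h2, bipSum_eq_sum_powerset 0]
  refine sum_congr (by congr!) fun B _ => ?_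
  have e1 : {x // x ∈ B} ≃ Fin B.card := B.equivFin
  have e2 : {x // x ∉ B} ≃ Fin (n + 1 - B.card) :=
    Fintype.equivFinOfCardEq (by simp [Fintype.card_subtype_compl])
  rw [bipSum_congr e1]
  congr 2
  convert connSum_congr e2 y

/-! ### Counting two-colorings -/

/-- Every edge of `G` joins a vertex of `A` to a vertex outside of `A`. -/
def IsCut {V : Type*} (G : SimpleGraph V) (A : Finset V) : Prop :=
  ∀ u v, G.Adj u v → (u ∈ A ↔ v ∉ A)

theorem isBipartite_iff_exists_isCut {V : Type*} [Fintype V] (G : SimpleGraph V) :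
    G.IsBipartite ↔ ∃ A, IsCut G A := by
  constructor
  · rintro ⟨c⟩
    refine ⟨univ.filter fun v => c v = 0, fun u v h => ?_⟩
    have := c.valid h
    simp only [mem_filter, mem_univ, true_and]
    omega
  · rintro ⟨A, hA⟩
    refine ⟨Coloring.mk (fun v => if v ∈ A then 0 else 1) fun {u v} h => ?_⟩
    have := hA u v h
    by_cases hu : u ∈ A <;> simp_all

/-- Given one two-coloring, the other ones correspond to the sets of components where the colors
are swapped. -/
def isCutEquiv {V : Type*} [Fintype V] {G : SimpleGraph V} {A₀ : Finset V} (h₀ : IsCut G A₀) :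
    {A : Finset V // IsCut G A} ≃ Set G.ConnectedComponent where
  toFun A := {c | ∃ v, G.connectedComponentMk v = c ∧ (v ∈ A.1 ↔ v ∈ A₀)}
  invFun T := ⟨univ.filter fun v => (v ∈ A₀ ↔ G.connectedComponentMk v ∈ T), fun u v h => by
    have h1 := h₀ u v h
    have h2 : G.connectedComponentMk u = G.connectedComponentMk v :=
      ConnectedComponent.sound h.reachable
    simp only [mem_filter, mem_univ, true_and, h2]
    tauto⟩
  left_inv A := by
    -- Both colorings flip along each edge, so their agreement is constant on components.
    have key : ∀ u v, G.Reachable u v → ((u ∈ A.1 ↔ u ∈ A₀) ↔ (v ∈ A.1 ↔ v ∈ A₀)) := by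
      rintro u v ⟨p⟩
      induction p with
      | nil => rfl
      | cons h p ih =>
        rw [← ih]
        have h1 := h₀ _ _ h
        have h2 := A.2 _ _ h
        tauto
    ext v
    have : G.connectedComponentMk v ∈ {c | ∃ v, G.connectedComponentMk v = c ∧
        (v ∈ A.1 ↔ v ∈ A₀)} ↔ (v ∈ A.1 ↔ v ∈ A₀) :=
      ⟨fun ⟨u, hu, h⟩ => (key u v (ConnectedComponent.exact hu)).1 h, fun h => ⟨v, rfl, h⟩⟩
    simp only [mem_filter, mem_univ, true_and, this]
    tauto
  right_inv T := by
    ext c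
    simp only [mem_filter, mem_univ, true_and, Set.mem_ofPred_eq]
    constructor
    · rintro ⟨v, rfl, h⟩
      tauto
    · induction c using ConnectedComponent.ind with
      | h v => exact fun h => ⟨v, rfl, by tauto⟩

theorem card_isCut {V : Type*} [Fintype V] (G : SimpleGraph V) :
    #{A : Finset V | IsCut G A} =
      if G.IsBipartite then 2 ^ Nat.card G.ConnectedComponent else 0 := by
  split_ifs with h
  · obtain ⟨A₀, h₀⟩ := (isBipartite_iff_exists_isCut G).1 h
    rw [← Fintype.card_subtype, ← Nat.card_eq_fintype_card, Nat.card_congr (isCutEquiv h₀),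
      Nat.card_eq_fintype_card, Fintype.card_set, Nat.card_eq_fintype_card]
  · rw [isBipartite_iff_exists_isCut] at h
    simpa [filter_eq_empty_iff] using h

/-- The edges of the complete bipartite graph with parts `A` and its complement. -/
def cutEdges {V : Type*} [Fintype V] (A : Finset V) : Finset (Sym2 V) :=
  (A ×ˢ Aᶜ).image fun p => s(p.1, p.2)

theorem card_cutEdges {V : Type*} [Fintype V] (A : Finset V) :
    #(cutEdges A) = #A * (Fintype.card V - #A) := by
  rw [cutEdges, card_image_of_injOn, card_product, card_compl]
  rintro ⟨a, b⟩ h ⟨c, d⟩ h' e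
  simp only [coe_product, Set.mem_prod, mem_coe, mem_compl] at h h'
  simp only [Sym2.eq_iff] at e
  rcases e with ⟨rfl, rfl⟩ | ⟨rfl, rfl⟩
  · rfl
  · exact absurd h.1 h'.2

theorem mk_mem_cutEdges {V : Type*} [Fintype V] {A : Finset V} {u v : V} :
    s(u, v) ∈ cutEdges A ↔ (u ∈ A ↔ v ∉ A) := by
  simp only [cutEdges, mem_image, mem_product, mem_compl, Prod.exists, Sym2.eq_iff]
  constructor
  · rintro ⟨a, b, ⟨ha, hb⟩, ⟨rfl, rfl⟩ | ⟨rfl, rfl⟩⟩ <;> tauto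
  · intro h
    by_cases hu : u ∈ A
    · exact ⟨u, v, ⟨hu, h.1 hu⟩, .inl ⟨rfl, rfl⟩⟩
    · exact ⟨v, u, ⟨by tauto, hu⟩, .inr ⟨rfl, rfl⟩⟩

theorem isCut_iff {V : Type*} [Fintype V] {G : SimpleGraph V} {A : Finset V} :
    IsCut G A ↔ G.edgeSet ⊆ cutEdges A := by
  constructor
  · intro h e
    induction e with
    | h u v => exact fun he => mk_mem_cutEdges.2 (h u v he)
  · exact fun h u v huv => mk_mem_cutEdges.1 (h (show s(u, v) ∈ G.edgeSet from huv))

/-- Graphs cut by `A` correspond to arbitrary subsets of `cutEdges A`; the sum is then the binomial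
theorem. -/
theorem sum_isCut {V : Type*} [Fintype V] (A : Finset V) (y : R) :
    ∑ G : SimpleGraph V with IsCut G A, y ^ G.edgeSet.ncard =
      (y + 1) ^ (#A * (Fintype.card V - #A)) := by
  rw [← card_cutEdges, ← sum_pow_mul_eq_add_pow]
  refine sum_bij' (fun G _ => univ.filter (· ∈ G.edgeSet)) (fun t _ => fromEdgeSet (t : Set (Sym2 V)))
    ?_ ?_ ?_ ?_ ?_
  · intro G hG
    rw [mem_filter] at hG
    rw [mem_powerset]
    intro e he
    rw [mem_filter] at he
    exact isCut_iff.1 hG.2 he.2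
  · intro t ht
    rw [mem_powerset] at ht
    rw [mem_filter]
    refine ⟨mem_univ _, isCut_iff.2 ?_⟩
    rw [edgeSet_fromEdgeSet]
    exact fun e he => ht he.1
  · intro G hG
    simp
  · intro t ht
    rw [mem_powerset] at ht
    ext e
    simp only [edgeSet_fromEdgeSet, mem_filter, mem_univ, true_and, Set.mem_sdiff, mem_coe]
    -- `fromEdgeSet` discards loops, but a loop has both ends on one side and so is never in
    -- `cutEdges A`.
    refine and_iff_left_of_imp fun he => ?_
    have := ht he
    induction e with
    | h u v =>
      rw [mk_mem_cutEdges] at this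
      rintro hd
      obtain rfl : u = v := by simpa using hd
      tauto
  · intro G hG
    rw [one_pow, mul_one, Set.ncard_eq_toFinset_card']
    congr 2
    ext e
    simp

theorem bipSum_two {V : Type*} [Fintype V] (y : R) :
    bipSum V y 2 = ∑ A : Finset V, (y + 1) ^ (#A * (Fintype.card V - #A)) := by
  have h (G : SimpleGraph V) :
      bipWeight y 2 G = ∑ A : Finset V, if IsCut G A then y ^ G.edgeSet.ncard else 0 := by
    rw [← sum_filter, sum_const, card_isCut, bipWeight, nsmul_eq_mul]
    split_ifs
    · push_cast
      ring
    · simp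
  simp only [bipSum, h]
  rw [sum_comm]
  refine sum_congr rfl fun A _ => ?_
  rw [← sum_filter, sum_isCut]

theorem bipSum_fin_two (n : ℕ) (y : R) :
    bipSum (Fin n) y 2 = ∑ i ∈ range (n + 1), n.choose i • (y + 1) ^ (i * (n - i)) := by
  have h := sum_powerset_apply_card (fun i => (y + 1) ^ (i * (n - i)))
    (x := (univ : Finset (Fin n)))
  rw [card_univ, Fintype.card_fin] at h
  rw [← h, bipSum_two, powerset_univ, Fintype.card_fin]

end WeightedSums

/-! ### Formal linear differential equations -/

/-- Coefficient `n` of the equation determines coefficient `n + 1` of the solution from the earlier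
ones, because `n + 1` is a unit in a `ℚ`-algebra. -/
theorem eq_of_derivative_eq_mul {A : Type*} [CommRing A] [Algebra ℚ A] {f g D : PowerSeries A}
    (hf : PowerSeries.derivative A f = D * f) (hg : PowerSeries.derivative A g = D * g)
    (h0 : PowerSeries.coeff 0 f = PowerSeries.coeff 0 g) : f = g := by
  have key : ∀ n, ∀ m ≤ n, PowerSeries.coeff m f = PowerSeries.coeff m g := by
    intro n
    induction n with
    | zero => intro m hm; rwa [Nat.le_zero.1 hm]
    | succ n ih =>
      intro m hm
      rcases Nat.lt_or_ge m (n + 1) with h | h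
      · exact ih m (by omega)
      obtain rfl : m = n + 1 := by omega
      have h1 := congrArg (PowerSeries.coeff n) hf
      have h2 := congrArg (PowerSeries.coeff n) hg
      rw [PowerSeries.coeff_derivative, PowerSeries.coeff_mul] at h1 h2
      have h3 : PowerSeries.coeff (n + 1) f * ((n : A) + 1) =
          PowerSeries.coeff (n + 1) g * ((n : A) + 1) := by
        rw [h1, h2]
        refine sum_congr rfl fun p hp => ?_
        rw [ih p.2 (by have := mem_antidiagonal.1 hp; omega)]
      have hu : IsUnit ((n : A) + 1) := by
        have := (IsUnit.mk0 ((n : ℚ) + 1) (by positivity)).map (algebraMap ℚ A)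
        simpa using this
      exact hu.mul_right_cancel h3
  ext n
  exact key n n le_rfl

theorem hasSubst_of_coeff_zero {A : Type*} [CommRing A] {f : PowerSeries A}
    (hf : PowerSeries.coeff 0 f = 0) : PowerSeries.HasSubst f :=
  PowerSeries.HasSubst.of_constantCoeff_zero' (by simpa using hf)

theorem derivative_expSeries {R : Type} [CommRing R] [Algebra ℚ R] {f : Series R}
    (hf : PowerSeries.coeff 0 f = 0) :
    PowerSeries.derivative _ (expSeries f) = PowerSeries.derivative _ f * expSeries f := by
  rw [expSeries, PowerSeries.derivative_subst (hasSubst_of_coeff_zero hf),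
    PowerSeries.derivative_exp, mul_comm]

theorem coeff_zero_expSeries {R : Type} [CommRing R] [Algebra ℚ R] {f : Series R}
    (hf : PowerSeries.coeff 0 f = 0) : PowerSeries.coeff 0 (expSeries f) = 1 := by
  -- The substitution lemma needs a vanishing constant term, hence `exp - 1`.
  have h := PowerSeries.constantCoeff_subst_eq_zero (a := f) (by simpa [← PowerSeries.constantCoeff_eq] using hf)
    (PowerSeries.exp (PowerSeries R) - 1) (by simp)
  have hs := hasSubst_of_coeff_zero hf
  rw [← PowerSeries.coe_substAlgHom hs, map_sub, map_one, PowerSeries.coe_substAlgHom hs] at h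
  rw [← PowerSeries.constantCoeff_eq, map_sub, map_one, sub_eq_zero] at h
  simpa [expSeries] using h

/-- Substitute `f - 1` into `(1 + X) * log' = 1` and apply the chain rule; the product form avoids
inverting `f`. -/
theorem derivative_logOf {A : Type*} [CommRing A] [Algebra ℚ A] {f : PowerSeries A}
    (hf : PowerSeries.coeff 0 f = 1) :
    f * PowerSeries.derivative A (PowerSeries.logOf f) = PowerSeries.derivative A f := by
  have hs : PowerSeries.HasSubst (f - 1) := hasSubst_of_coeff_zero
    (by rw [map_sub, hf, PowerSeries.coeff_zero_one, sub_self])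
  have h1 : (1 + PowerSeries.X) * PowerSeries.derivative A (PowerSeries.log A) = 1 := by
    rw [PowerSeries.deriv_log]
    ext n
    rw [add_mul, one_mul, map_add, PowerSeries.coeff_mk]
    cases n with
    | zero => simp
    | succ n =>
      rw [PowerSeries.coeff_succ_X_mul, PowerSeries.coeff_mk, ← map_add]
      simp [pow_succ, PowerSeries.coeff_one]
  have h2 := congrArg (PowerSeries.substAlgHom hs) h1
  rw [map_mul, map_one, map_add, map_one, PowerSeries.substAlgHom_X,
    PowerSeries.coe_substAlgHom, add_sub_cancel] at h2
  rw [PowerSeries.logOf_eq, PowerSeries.derivative_subst hs, ← mul_assoc, h2, one_mul, map_sub,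
    PowerSeries.derivative_one, sub_zero]

theorem derivative_map {A A' : Type*} [CommRing A] [CommRing A'] (φ : A →+* A')
    (f : PowerSeries A) :
    PowerSeries.derivative A' (PowerSeries.map φ f) =
      PowerSeries.map φ (PowerSeries.derivative A f) := by
  ext n
  simp [PowerSeries.coeff_derivative]

/-! ### Generating functions -/

/-- The exponential generating function of bipartite graphs, where a component has weight `t`. -/
def bipSeries (R : Type) [CommRing R] [Algebra ℚ R] (t : R) : Series R :=
  PowerSeries.mk fun n => (n.factorial : ℚ)⁻¹ • bipSum (Fin n) PowerSeries.X (PowerSeries.C t)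

/-- The exponential generating function of connected bipartite graphs. -/
def connSeries (R : Type) [CommRing R] [Algebra ℚ R] : Series R :=
  PowerSeries.mk fun n => (n.factorial : ℚ)⁻¹ • connSum (Fin n) PowerSeries.X

section Series

variable {R : Type} [CommRing R]

theorem coeff_bipSum (V : Type*) [Fintype V] (k : ℕ) (t : R) :
    PowerSeries.coeff k (bipSum V PowerSeries.X (PowerSeries.C t)) =
      ∑ G : SimpleGraph V with G.IsBipartite ∧ G.edgeSet.ncard = k,
        t ^ Nat.card G.ConnectedComponent := by
  rw [bipSum, map_sum, sum_filter]
  refine sum_congr rfl fun G _ => ?_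
  rw [bipWeight]
  by_cases h : G.IsBipartite
  · simp only [h, if_true, true_and, ← map_pow, PowerSeries.coeff_mul_C, PowerSeries.coeff_X_pow]
    simp [eq_comm]
  · simp [h]

theorem coeff_connSum (V : Type*) [Fintype V] (k : ℕ) :
    PowerSeries.coeff k (connSum V (PowerSeries.X : PowerSeries R)) =
      Nat.card {G : SimpleGraph V // G.IsBipartite ∧ G.Connected ∧ G.edgeSet.ncard = k} := by
  rw [connSum, map_sum, Nat.card_eq_fintype_card, Fintype.card_subtype,
    card_filter, Nat.cast_sum]
  refine sum_congr rfl fun G _ => ?_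
  rw [connWeight]
  by_cases h : G.IsBipartite ∧ G.Connected
  · simp [h, PowerSeries.coeff_X_pow, eq_comm]
  · rw [if_neg h, if_neg (by tauto)]
    simp

theorem connSum_fin_zero (y : R) : connSum (Fin 0) y = 0 := by
  refine sum_eq_zero fun G _ => if_neg fun h => ?_
  exact h.2.nonempty.elim fun i => i.elim0

theorem bipSum_fin_zero (y z : R) : bipSum (Fin 0) y z = 1 := by
  have h (G : SimpleGraph (Fin 0)) : bipWeight y z G = 1 := by
    have hb : G.IsBipartite := ⟨Coloring.mk (fun _ => 0) fun {v} => v.elim0⟩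
    have he : G.edgeSet.ncard = 0 := by
      rw [Set.ncard_eq_zero]
      ext e
      induction e with
      | h u v => exact u.elim0
    have : IsEmpty G.ConnectedComponent := ⟨fun c => by
      induction c using ConnectedComponent.ind with
      | h v => exact v.elim0⟩
    simp [bipWeight, hb, he]
  simp [bipSum, h]

variable [Algebra ℚ R]

theorem coeff_zero_connSeries : PowerSeries.coeff 0 (connSeries R) = 0 := by
  simp only [connSeries, PowerSeries.coeff_mk, connSum_fin_zero, smul_zero]

theorem coeff_zero_bipSeries (t : R) : PowerSeries.coeff 0 (bipSeries R t) = 1 := by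
  simp only [bipSeries, PowerSeries.coeff_mk, bipSum_fin_zero]
  simp

theorem derivative_bipSeries (t : R) :
    PowerSeries.derivative _ (bipSeries R t) =
      PowerSeries.derivative _ (PowerSeries.C (PowerSeries.C t) * connSeries R) *
        bipSeries R t := by
  ext1 n
  rw [mul_comm, PowerSeries.coeff_derivative, PowerSeries.coeff_mul, bipSeries, connSeries,
    PowerSeries.coeff_mk, bipSum_fin_succ, Nat.sum_antidiagonal_eq_sum_range_succ_mk, smul_sum,
    sum_mul]
  refine sum_congr rfl fun j hj => ?_
  have hj : j ≤ n := Nat.lt_succ_iff.1 (mem_range.1 hj)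
  simp only [PowerSeries.coeff_derivative, PowerSeries.coeff_C_mul, PowerSeries.coeff_mk,
    ← Nat.sub_add_comm hj]
  have hc : (n.choose j : ℚ) = n.factorial / (j.factorial * (n - j).factorial) :=
    Nat.cast_choose ℚ hj
  -- The factor `n + 1` from the derivative turns `1 / (n + 1)!` into `1 / n!`, matching the
  -- binomial convolution.
  have h1 : ((n + 1).factorial : ℚ)⁻¹ * n.choose j * (n + 1) =
      ((n + 1 - j).factorial : ℚ)⁻¹ * ((n - j : ℕ) + 1) * (j.factorial : ℚ)⁻¹ := by
    rw [hc, Nat.sub_add_comm hj, Nat.factorial_succ, Nat.factorial_succ]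
    push_cast
    field_simp
  have h2 := congrArg (algebraMap ℚ (PowerSeries R)) h1
  simp only [map_mul, map_add, map_natCast, map_one] at h2
  simp only [Algebra.smul_def, nsmul_eq_mul]
  linear_combination (PowerSeries.C t * connSum (Fin (n + 1 - j)) PowerSeries.X *
    bipSum (Fin j) PowerSeries.X (PowerSeries.C t)) * h2

end Series

theorem bipSeries_two : bipSeries ℚ 2 = bicolored := by
  ext n k
  have h2 : (PowerSeries.C (2 : ℚ)) = 2 := map_ofNat _ 2
  rw [bipSeries, PowerSeries.coeff_mk, h2, bipSum_fin_two, bicolored, series, map_add,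
    PowerSeries.coeff_mk]
  rcases Nat.eq_zero_or_pos n with rfl | hn
  · simp [PowerSeries.coeff_one]
  · have hc (m : ℕ) : PowerSeries.coeff k ((PowerSeries.X + 1 : PowerSeries ℚ) ^ m) =
        m.choose k := by
      have := Polynomial.coeff_X_add_one_pow ℚ m k
      rw [← Polynomial.coeff_coe] at this
      simpa using this
    rw [PowerSeries.coeff_one, if_neg hn.ne']
    simp only [PowerSeries.coeff_smul, map_sum, map_nsmul, hc, hn.ne', if_false,
      PowerSeries.coeff_mk, zero_add]
    simp [div_eq_inv_mul]

/-- Cancelling `bicolored` between its two differential equations shows that its logarithm and `2 C`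
have equal derivatives; both have constant term `0`. -/
theorem B_eq_connSeries : B = connSeries ℚ := by
  have h0 : PowerSeries.coeff 0 bicolored = 1 := by
    rw [← bipSeries_two, coeff_zero_bipSeries]
  have h1 := derivative_logOf h0
  have h2 := derivative_bipSeries (2 : ℚ)
  rw [bipSeries_two, ← h1, mul_comm] at h2
  have hne : bicolored ≠ 0 := fun h => by simp [h] at h0
  have : IsAddTorsionFree (PowerSeries ℚ) := IsAddTorsionFree.of_module_rat _
  have h3 : PowerSeries.logOf bicolored = PowerSeries.C (PowerSeries.C 2) * connSeries ℚ := by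
    refine PowerSeries.derivative.ext (mul_right_cancel₀ hne h2) ?_
    rw [PowerSeries.constantCoeff_logOf (by simpa using h0)]
    have := coeff_zero_connSeries (R := ℚ)
    simp only [PowerSeries.coeff_zero_eq_constantCoeff] at this
    simp [this]
  rw [B, h3]
  ext n k
  simp

theorem coeffXY_B (n k : ℕ) :
    coeffXY n k B = (connectedBipartiteCount n k : ℚ) / (n.factorial : ℚ) := by
  rw [B_eq_connSeries, coeffXY, connSeries, PowerSeries.coeff_mk, PowerSeries.coeff_smul,
    coeff_connSum, smul_eq_mul, div_eq_inv_mul,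
    connectedBipartiteCount]

theorem tauSeries_tilde_B :
    tauSeries (fun _ => 1) (tilde B) =
      PowerSeries.C (PowerSeries.C z) * connSeries ZField := by
  ext n k
  rw [tauSeries, PowerSeries.coeff_map, PowerSeries.coeff_map, tilde, series,
    PowerSeries.coeff_mk, PowerSeries.coeff_mk, PowerSeries.coeff_C_mul, PowerSeries.coeff_C_mul]
  split_ifs with h
  · rw [coeffXY_B, connSeries, PowerSeries.coeff_mk, PowerSeries.coeff_smul, coeff_connSum,
      map_mul, mul_comm, connectedBipartiteCount]
    have h1 : tau (fun _ => 1) (MvPolynomial.X ⟨n, h⟩) = z :=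
      (MvPolynomial.aeval_X _ _).trans zPow_one
    rw [h1]
    simp [tau, Algebra.smul_def, div_eq_inv_mul]
  -- The default `0` in `tilde` is right here: the empty graph is not connected.
  · obtain rfl : n = 0 := by omega
    simp [coeff_zero_connSeries]

/-- Comparing differential equations avoids having to commute `tauSeries` with the substitution
defining `expSeries`. -/
theorem tauSeries_expSeries_tilde_B :
    tauSeries (fun _ => 1) (expSeries (tilde B)) = bipSeries ZField z := by
  have h0 : PowerSeries.coeff 0 (tilde B) = 0 := by
    ext k
    simp [tilde, series]
  refine eq_of_derivative_eq_mul ?_ (derivative_bipSeries z) ?_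
  · rw [← tauSeries_tilde_B, tauSeries, derivative_map, derivative_expSeries h0, map_mul,
      derivative_map]
  · rw [tauSeries, PowerSeries.coeff_map, coeff_zero_expSeries h0, map_one, coeff_zero_bipSeries]

/-! ### Expansions in powers of `z` -/

/-- The numbers of bipartite graphs on `V` with `k` edges, by the number of components. -/
def componentCounts (V : Type*) [Fintype V] (k : ℕ) : ℕ →₀ ℚ :=
  ∑ G : SimpleGraph V with G.IsBipartite ∧ G.edgeSet.ncard = k,
    Finsupp.single (Nat.card G.ConnectedComponent) 1

theorem componentCounts_apply (V : Type*) [Fintype V] (k ν : ℕ) :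
    componentCounts V k ν = Nat.card {G : SimpleGraph V //
      G.IsBipartite ∧ G.edgeSet.ncard = k ∧ Nat.card G.ConnectedComponent = ν} := by
  rw [componentCounts, Finsupp.finsetSum_apply, Nat.card_eq_fintype_card, Fintype.card_subtype]
  simp only [Finsupp.single_apply]
  rw [← sum_filter, filter_filter]
  simp [and_assoc]

theorem sum_componentCounts (V : Type*) [Fintype V] (k : ℕ) (c : ℚ) :
    ((componentCounts V k).sum fun ν a => algebraMap ℚ ZField (a / c) * z ^ ν) =
      c⁻¹ • ∑ G : SimpleGraph V with G.IsBipartite ∧ G.edgeSet.ncard = k,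
        z ^ Nat.card G.ConnectedComponent := by
  rw [componentCounts,
    ← Finsupp.sum_finsetSum_index (by simp) (by intros; rw [add_div, map_add, add_mul]),
    Algebra.smul_def, mul_sum]
  refine sum_congr rfl fun G _ => ?_
  rw [Finsupp.sum_single_index (by simp), one_div]

theorem hasExpansion_componentCounts :
    HasExpansion (bipSeries ZField z) fun n k => componentCounts (Fin n) k := by
  ext n k
  rw [bipSeries, series, PowerSeries.coeff_mk, PowerSeries.coeff_mk, PowerSeries.coeff_mk,
    PowerSeries.coeff_smul, coeff_bipSum, sum_componentCounts]

theorem transcendental_z : Transcendental ℚ z := by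
  rintro ⟨p, hp, h⟩
  -- Any two ring homomorphisms out of `ℚ` agree, which reconciles the different algebra structures.
  have hcomp : algebraMap ℚ ZField =
      (algebraMap (RatFunc ℚ) ZField).comp
        (@algebraMap ℚ (RatFunc ℚ) _ _ (RatFunc.instAlgebraOfPolynomial ℚ ℚ)) :=
    Subsingleton.elim _ _
  rw [Polynomial.aeval_def, hcomp, z, ← Polynomial.hom_eval₂, map_eq_zero] at h
  exact RatFunc.transcendental_X ⟨p, hp, h⟩

/-- Finite support makes each coefficient a polynomial evaluated at `z`, and evaluation at a
transcendental element is injective. -/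
theorem HasExpansion.unique {F : Series ZField} {b c : ℕ → ℕ → ℕ →₀ ℚ} (hb : HasExpansion F b)
    (hc : HasExpansion F c) : b = c := by
  ext n k ν
  have h : ∀ a : ℕ → ℕ → ℕ →₀ ℚ, HasExpansion F a →
      coeffXY n k F = Polynomial.aeval z
        ((a n k).sum fun ν q => Polynomial.monomial ν (q / (n.factorial : ℚ))) := by
    intro a ha
    rw [ha, coeffXY, series, PowerSeries.coeff_mk, PowerSeries.coeff_mk, map_finsuppSum]
    simp only [Polynomial.aeval_monomial]
  have hcoeff (p : ℕ →₀ ℚ) :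
      (p.sum fun ν q => Polynomial.monomial ν (q / (n.factorial : ℚ))).coeff ν =
        p ν / n.factorial := by
    rw [Finsupp.sum, Polynomial.finsetSum_coeff]
    simp only [Polynomial.coeff_monomial]
    rw [sum_ite_eq']
    split_ifs with hν
    · rfl
    · simp [Finsupp.notMem_support_iff.1 hν]
  have h1 := transcendental_iff_injective.1 transcendental_z ((h b hb).symm.trans (h c hc))
  have h2 := congrArg (fun p => Polynomial.coeff p ν) h1
  simp only [hcoeff] at h2
  exact (div_left_inj' (by positivity)).1 h2

end

end BipartiteEnum

theorem corollary4p2 :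
    (∀ n k : ℕ, BipartiteEnum.coeffXY n k BipartiteEnum.B =
      (BipartiteEnum.connectedBipartiteCount n k : ℚ) / (n.factorial : ℚ)) ∧
    (∃ b : ℕ → ℕ → ℕ →₀ ℚ, BipartiteEnum.HasExpansion
      (BipartiteEnum.tauSeries (fun _ => 1)
        (BipartiteEnum.expSeries (BipartiteEnum.tilde BipartiteEnum.B))) b) ∧
    (∀ b : ℕ → ℕ → ℕ →₀ ℚ, BipartiteEnum.HasExpansion
      (BipartiteEnum.tauSeries (fun _ => 1)
        (BipartiteEnum.expSeries (BipartiteEnum.tilde BipartiteEnum.B))) b →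
      ∀ n k ν : ℕ, b n k ν = (BipartiteEnum.bipartiteCount n k ν : ℚ)) := by
  rw [BipartiteEnum.tauSeries_expSeries_tilde_B]
  refine ⟨BipartiteEnum.coeffXY_B, ⟨_, BipartiteEnum.hasExpansion_componentCounts⟩,
    fun b hb n k ν => ?_⟩
  rw [hb.unique BipartiteEnum.hasExpansion_componentCounts, BipartiteEnum.bipartiteCount]
  exact BipartiteEnum.componentCounts_apply _ k ν
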